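/- Let $(U_k)_{k\ge 1}$ be i.i.d. random variables uniformly distributed on $[0,1]$, and for $n\ge 1$ let $Z_n(s)=\sum_{k=1}^n e^{-sU_k}$, $s\in\mathbb{R}$. Let $M(s)=\frac{1-e^{-s}}{s}$ for $s\in\mathbb{C}\setminus\{0\}$, $M(0)=1$, and $C_Z(s,w)=M(s+w)-M(s)M(w)$ for $s,w\in\mathbb{C}$. Let $C(\mathbb{R},\mathbb{R})$ carry the topology of locally uniform convergence and its Borel $\sigma$-algebra. Then: 1. $\mathbb{E}[Z_n(s)]=nM(s)$ for all $n$ and all $s\in\mathbb{R}$. 2. There is a random element $Z$ of $C(\mathbb{R},\mathbb{R})$ which is a centred Gaussian process with covariance $\mathbb{E}[Z(s)Z(w)]=C_Z(s,w)$, $s,w\in\mathbb{R}$, and for every such $Z$ (on any probability space) the random functions $s\mapsto \frac{Z_n(s)-nM(s)}{\sqrt n}$ converge in law to $Z$ in $C(\mathbb{R},\mathbb{R})$ as $n\to\infty$. 3. The functions $C_Z(s,\cdot)$ and $C_Z(\cdot,w)$ are entire for all $s,w\in\mathbb{C}$, and every $Z$ as in 2 extends to a holomorphic Gaussian process on $\mathbb{C}$: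 on the same probability space there is a process $(\widetilde Z(s))_{s\in\mathbb{C}}$ all of whose paths are entire functions, such that almost surely $\widetilde Z(s)=Z(s)$ for all $s\in\mathbb{R}$, which is a centred complex Gaussian process (real and imaginary parts jointly Gaussian) with $\mathbb{E}[\widetilde Z(s)\widetilde Z(w)]=C_Z(s,w)$ for all $s,w\in\mathbb{C}$. -/

import Mathlib

open MeasureTheory ProbabilityTheory Filter

noncomputable section

namespace UniformLaplace

/-- The space `C(ℝ, ℝ)` carries the compact-open topology, i.e. locally uniform convergence;
we equip it with the Borel σ-algebra. -/
instance instMeasurableSpacePathSpace : MeasurableSpace C(ℝ, ℝ) := borel C(ℝ, ℝ)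

instance instBorelSpacePathSpace : BorelSpace C(ℝ, ℝ) := ⟨rfl⟩

/-- `M(s) = (1 - e^{-s}) / s` for real `s`, with its continuous value `M(0) = 1`. -/
def M (s : ℝ) : ℝ := if s = 0 then 1 else (1 - Real.exp (-s)) / s

/-- `M(s) = (1 - e^{-s}) / s` for complex `s`, with its continuous value `M(0) = 1`. -/
def Mc (s : ℂ) : ℂ := if s = 0 then 1 else (1 - Complex.exp (-s)) / s

/-- `C_Z(s, w) = M(s + w) - M(s) M(w)` for real `s, w`. -/
def cov (s w : ℝ) : ℝ := M (s + w) - M s * M w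

/-- `C_Z(s, w) = M(s + w) - M(s) M(w)` for complex `s, w`. -/
def covc (s w : ℂ) : ℂ := Mc (s + w) - Mc s * Mc w

theorem M_eq_dslope : M = dslope (fun s : ℝ => 1 - Real.exp (-s)) 0 := by
  funext s
  by_cases h : s = 0
  · subst h
    have hd : HasDerivAt (fun s : ℝ => 1 - Real.exp (-s)) 1 0 := by
      simpa using ((hasDerivAt_neg (0 : ℝ)).exp).const_sub 1
    rw [dslope_same, hd.deriv, M, if_pos rfl]
  · rw [dslope_of_ne _ h, slope_def_field, M, if_neg h]
    simp

theorem continuous_M : Continuous M := by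
  rw [M_eq_dslope, ← continuousOn_univ, continuousOn_dslope univ_mem]
  refine ⟨by fun_prop, by fun_prop⟩

/-- `Z_n(s) = ∑_k e^{-s U_k}`, the sum running over the first `n` terms of the sequence `U`. -/
def Zn {Ω : Type*} (U : ℕ → Ω → ℝ) (n : ℕ) (s : ℝ) (ω : Ω) : ℝ :=
  ∑ k ∈ Finset.range n, Real.exp (-(s * U k ω))

/-- The random element `s ↦ (Z_n(s) - n M(s)) / √n` of `C(ℝ, ℝ)`. -/
def scaledZn {Ω : Type*} (U : ℕ → Ω → ℝ) (n : ℕ) (ω : Ω) : C(ℝ, ℝ) where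
  toFun s := (Zn U n s ω - n * M s) / √n
  continuous_toFun := by
    have := continuous_M
    unfold Zn
    fun_prop

/-- The real process `X` is centred Gaussian with covariance function `K`. -/
structure IsCentredGaussian {Ω T : Type*} [MeasurableSpace Ω] (X : T → Ω → ℝ)
    (K : T → T → ℝ) (Q : Measure Ω) : Prop where
  gaussian : IsGaussianProcess X Q
  mean (s : T) : ∫ ω, X s ω ∂Q = 0
  covariance (s w : T) : ∫ ω, X s ω * X w ω ∂Q = K s w

/-- The complex process `X` is centred Gaussian (real and imaginary parts are jointly Gaussian)
and `E[X(s) X(w)] = K(s, w)`, without complex conjugation. -/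
structure IsCentredGaussianC {Ω T : Type*} [MeasurableSpace Ω] (X : T → Ω → ℂ)
    (K : T → T → ℂ) (Q : Measure Ω) : Prop where
  gaussian : IsGaussianProcess X Q
  mean (s : T) : ∫ ω, X s ω ∂Q = 0
  covariance (s w : T) : ∫ ω, X s ω * X w ω ∂Q = K s w

end UniformLaplace

end

noncomputable section

namespace UniformLaplace

open Topology Complex

/-! ### The Polish space of entire functions real on the real line. -/

section EntireFunctions

/-! Everything is done first for entire functions and then restricted to `ℝ`. The normalised sums
are random elements of the Polish space `realEntire`. In the basis `(-s)^j / j!` their coefficients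
are normalised centred sums of `U_k ^ j`, with variance at most 1 for every `n` and `j`. Chebyshev
with thresholds `R 2^j` confines all coefficients to a compact box with high probability, and the
factorials make the box's image in `realEntire` compact. This gives tightness
(`isTightMeasureSet_entirePath`).

By Prokhorov there is a limit point `μ`. The one-dimensional central limit theorem, applied to every
real linear functional of finitely many values, identifies it (`isLimitLaw_of_tendsto`), so `μ`
realises the limiting process.

For an arbitrary realisation `Z`, the covariance fixes the laws of finite linear combinations of
values; with tightness this gives convergence in `C(ℝ, ℝ)` (`tendsto_of_tight_of_tendsto_map`).
Uniqueness of the limit gives `Z` the law of the restriction of `μ`. Restriction to `ℝ` is injective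
and continuous between Polish spaces, hence has a measurable left inverse, which applied to `Z`
yields the holomorphic extension. -/

instance : MeasurableSpace C(ℂ, ℂ) := borel C(ℂ, ℂ)

instance : BorelSpace C(ℂ, ℂ) := ⟨rfl⟩

instance polishSpace_continuousMap {X Y : Type*} [TopologicalSpace X] [SecondCountableTopology X]
    [LocallyCompactSpace X] [UniformSpace Y] [CompleteSpace Y] [SecondCountableTopology Y]
    [T0Space Y] [(uniformity Y).IsCountablyGenerated] : PolishSpace C(X, Y) where
  toIsCompletelyMetrizableSpace := inferInstance

/-- The entire functions that are real on the real line, as a closed subset of `C(ℂ, ℂ)`. -/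
def realEntire : Set C(ℂ, ℂ) := {f | Differentiable ℂ f ∧ ∀ x : ℝ, (f x).im = 0}

/-- Weierstrass: locally uniform limits of holomorphic functions are holomorphic, and being real at
a point is a closed condition. -/
theorem isClosed_realEntire : IsClosed realEntire := by
  have h1 : IsClosed {f : C(ℂ, ℂ) | Differentiable ℂ f} := by
    rw [isClosed_iff_clusterPt]
    intro f hf
    have hf' : (𝓝 f ⊓ 𝓟 {f : C(ℂ, ℂ) | Differentiable ℂ f}).NeBot := hf
    have hlim : Tendsto id (𝓝 f ⊓ 𝓟 {f : C(ℂ, ℂ) | Differentiable ℂ f}) (𝓝 f) :=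
      tendsto_id.mono_left inf_le_left
    rw [ContinuousMap.tendsto_iff_tendstoLocallyUniformly] at hlim
    have := (tendstoLocallyUniformlyOn_univ.2 hlim).differentiableOn
      (Eventually.filter_mono inf_le_right <| eventually_principal.2 fun g hg =>
        Differentiable.differentiableOn hg) isOpen_univ
    exact differentiableOn_univ.1 this
  have h2 : IsClosed {f : C(ℂ, ℂ) | ∀ x : ℝ, (f x).im = 0} := by
    simp only [Set.ofPred_forall]
    exact isClosed_iInter fun x =>
      isClosed_eq (continuous_im.comp (continuous_eval_const (x : ℂ))) continuous_const
  exact h1.inter h2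

instance : PolishSpace realEntire := isClosed_realEntire.polishSpace

/-- Restriction of an entire function to the real line. -/
def restrictReal (f : realEntire) : C(ℝ, ℝ) :=
  (⟨re, continuous_re⟩ : C(ℂ, ℝ)).comp (f.1.comp ⟨ofReal, continuous_ofReal⟩)

@[simp]
theorem restrictReal_apply (f : realEntire) (x : ℝ) : restrictReal f x = (f.1 x).re := rfl

theorem ofReal_restrictReal (f : realEntire) (x : ℝ) : (restrictReal f x : ℂ) = f.1 x :=
  Complex.ext rfl (f.2.2 x).symm

theorem continuous_restrictReal : Continuous restrictReal :=
  (ContinuousMap.continuous_postcomp _).comp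
    ((ContinuousMap.continuous_precomp _).comp continuous_subtype_val)

/-- Identity theorem: the real points accumulate at 0. -/
theorem injective_restrictReal : Function.Injective restrictReal := by
  intro f g h
  have hf : AnalyticOnNhd ℂ f.1 Set.univ := f.2.1.differentiableOn.analyticOnNhd isOpen_univ
  have hg : AnalyticOnNhd ℂ g.1 Set.univ := g.2.1.differentiableOn.analyticOnNhd isOpen_univ
  have hfreq : ∃ᶠ z in 𝓝[≠] (0 : ℂ), f.1 z = g.1 z := by
    have ht : Tendsto (fun x : ℝ => (x : ℂ)) (𝓝[≠] 0) (𝓝[≠] 0) := by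
      refine tendsto_nhdsWithin_iff.2 ⟨?_, ?_⟩
      · exact (continuous_ofReal.tendsto' 0 0 (by simp)).mono_left inf_le_left
      · filter_upwards [self_mem_nhdsWithin] with x hx
        simpa using hx
    refine ht.frequently (Eventually.frequently (Eventually.of_forall fun x => ?_))
    rw [← ofReal_restrictReal, ← ofReal_restrictReal, h]
  have := hf.eq_of_frequently_eq hg hfreq
  exact Subtype.ext (DFunLike.coe_injective this)

end EntireFunctions

/-! ### The Laplace transform of the uniform law as an entire function. -/

section LaplaceTransform

theorem Mc_eq_dslope : Mc = dslope (fun s : ℂ => 1 - exp (-s)) 0 := by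
  funext s
  by_cases h : s = 0
  · subst h
    have hd : HasDerivAt (fun s : ℂ => 1 - exp (-s)) 1 0 := by
      simpa using ((hasDerivAt_neg (0 : ℂ)).cexp).const_sub 1
    rw [dslope_same, hd.deriv, Mc, if_pos rfl]
  · rw [dslope_of_ne _ h, slope_def_field, Mc, if_neg h]
    simp

/-- Removable singularity: the divided slope of an entire function is entire. -/
theorem differentiable_Mc : Differentiable ℂ Mc := by
  rw [Mc_eq_dslope, ← differentiableOn_univ, differentiableOn_dslope univ_mem]
  fun_prop

@[simp]
theorem Mc_ofReal (s : ℝ) : Mc s = M s := by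
  by_cases h : s = 0 <;> simp [Mc, M, h]

theorem covc_ofReal (s w : ℝ) : covc s w = cov s w := by
  simp only [covc, cov, ofReal_sub, ofReal_mul, ← Mc_ofReal, ofReal_add]

theorem Mc_eq_integral (s : ℂ) : Mc s = ∫ u in (0 : ℝ)..1, exp (-(s * u)) := by
  by_cases h : s = 0
  · simp [Mc, h]
  · have := integral_exp_mul_complex (a := 0) (b := 1) (neg_ne_zero.2 h)
    simp only [neg_mul] at this
    rw [this, Mc, if_neg h]
    simp
    field_simp
    ring

theorem hasSum_exp_neg_mul (s u : ℂ) :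
    HasSum (fun j : ℕ => (-s) ^ j / j.factorial * u ^ j) (exp (-(s * u))) := by
  have := NormedSpace.expSeries_div_hasSum_exp (𝔸 := ℂ) (-(s * u))
  rw [← exp_eq_exp_ℂ] at this
  refine this.congr_fun ?_
  intro j
  rw [← neg_mul, mul_pow]
  ring

/-- The factors `1 / (j + 1)` are the moments of the uniform law, so subtracting this series centres
each power sum separately. -/
theorem hasSum_Mc (s : ℂ) :
    HasSum (fun j : ℕ => (-s) ^ j / j.factorial * (1 / (j + 1) : ℂ)) (Mc s) := by
  by_cases h : s = 0
  · subst h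
    have : Mc 0 = (-0) ^ 0 / (Nat.factorial 0 : ℂ) * (1 / ((0 : ℕ) + 1) : ℂ) := by simp [Mc]
    rw [this]
    refine hasSum_single 0 fun j hj => ?_
    simp [hj]
  -- Drop the constant term of the exponential series and divide by `-s`.
  · have := hasSum_exp_neg_mul s 1
    rw [← hasSum_nat_add_iff' 1] at this
    have hM : Mc s = (-s)⁻¹ *
        (exp (-(s * 1)) - ∑ i ∈ Finset.range 1, (-s) ^ i / i.factorial * 1 ^ i) := by
      rw [Mc, if_neg h]
      simp
      field_simp
      ring
    rw [hM]
    refine (this.mul_left (-s)⁻¹).congr_fun fun j => ?_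
    have h1 : ((j : ℂ) + 1) ≠ 0 := by exact_mod_cast Nat.succ_ne_zero j
    have h2 : (j.factorial : ℂ) ≠ 0 := by exact_mod_cast j.factorial_ne_zero
    rw [Nat.factorial_succ]
    push_cast
    field_simp
    ring

end LaplaceTransform

/-! ### The normalised sums as entire functions. -/

/-- The process `s ↦ (∑_{k < n} e^{-s u_k} - n M(s)) / √n` on `ℂ`, as a function of the sample. -/
def entirePath (n : ℕ) (u : ℕ → ℝ) : realEntire where
  val :=
    { toFun := fun s => (∑ k ∈ Finset.range n, exp (-(s * u k)) - n * Mc s) / √n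
      continuous_toFun := by
        have := differentiable_Mc.continuous
        fun_prop }
  property := by
    constructor
    · have := differentiable_Mc
      simp only [ContinuousMap.coe_mk]
      fun_prop
    · intro x
      simp only [ContinuousMap.coe_mk, Mc_ofReal]
      exact_mod_cast ofReal_im ((∑ k ∈ Finset.range n, Real.exp (-(x * u k)) - n * M x) / √n)

theorem entirePath_apply (n : ℕ) (u : ℕ → ℝ) (s : ℂ) : (entirePath n u).1 s =
    (∑ k ∈ Finset.range n, exp (-(s * u k)) - n * Mc s) / √n := rfl

theorem continuous_entirePath (n : ℕ) : Continuous (entirePath n) := by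
  refine Continuous.subtype_mk (ContinuousMap.continuous_of_continuous_uncurry _ ?_) _
  have := differentiable_Mc.continuous
  simp only [Function.uncurry_def, ContinuousMap.coe_mk]
  fun_prop

theorem restrictReal_entirePath {Ω : Type*} (U : ℕ → Ω → ℝ) (n : ℕ) (ω : Ω) :
    restrictReal (entirePath n fun k => U k ω) = scaledZn U n ω := by
  ext x
  apply ofReal_injective
  rw [ofReal_restrictReal, entirePath_apply, Mc_ofReal]
  simp [scaledZn, Zn]

/-! ### Compact sets of entire functions from bounds on Taylor coefficients. -/

section PowerSeries

/-- The coefficient sequences `x` with `|x_j| ≤ R 2^j`. -/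
def coeffBox (R : ℝ) : Set (ℕ → ℝ) := Set.univ.pi fun j => Set.Icc (-(R * 2 ^ j)) (R * 2 ^ j)

theorem isCompact_coeffBox (R : ℝ) : IsCompact (coeffBox R) :=
  isCompact_univ_pi fun _ => isCompact_Icc

theorem norm_term_le {R r : ℝ} {x : ℕ → ℝ} (hx : x ∈ coeffBox R) {s : ℂ} (hs : ‖s‖ ≤ r) (j : ℕ) :
    ‖(-s) ^ j / j.factorial * x j‖ ≤ R * ((2 * r) ^ j / j.factorial) := by
  have h1 : |x j| ≤ R * 2 ^ j := abs_le.2 (hx j trivial)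
  rw [norm_mul, norm_div, norm_pow, norm_neg, norm_natCast, norm_real, Real.norm_eq_abs]
  calc ‖s‖ ^ j / j.factorial * |x j| ≤ r ^ j / j.factorial * (R * 2 ^ j) := by
        gcongr
        exact div_nonneg (pow_nonneg ((norm_nonneg s).trans hs) _) (by positivity)
    _ = R * ((2 * r) ^ j / j.factorial) := by rw [mul_pow]; ring

theorem summable_majorant (R r : ℝ) : Summable fun j : ℕ => R * ((2 * r) ^ j / j.factorial) :=
  (Real.summable_pow_div_factorial _).mul_left _

/-- The growth `2^j` allowed by the box is absorbed by `j!`, so the series has a summable majorant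
that is uniform over the box and over bounded `s`. -/
theorem continuous_uncurry_series (R : ℝ) :
    Continuous fun p : coeffBox R × ℂ => ∑' j : ℕ, (-p.2) ^ j / j.factorial * (p.1.1 j : ℂ) := by
  rw [continuous_iff_continuousAt]
  rintro ⟨x, s⟩
  have hU : (Set.univ ×ˢ Metric.ball 0 (‖s‖ + 1) : Set (coeffBox R × ℂ)) ∈ 𝓝 (x, s) :=
    (isOpen_univ.prod Metric.isOpen_ball).mem_nhds ⟨trivial, by simp⟩
  refine ContinuousOn.continuousAt (continuousOn_tsum (fun j => ?_)
    (summable_majorant R (‖s‖ + 1)) fun j p hp => norm_term_le p.1.2 ?_ j) hU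
  · exact (((continuous_snd.neg.pow j).div_const _).mul (continuous_ofReal.comp
      ((continuous_apply j).comp (continuous_subtype_val.comp continuous_fst)))).continuousOn
  · simpa using (mem_ball_zero_iff.1 hp.2).le

theorem differentiable_series {R : ℝ} {x : ℕ → ℝ} (hx : x ∈ coeffBox R) :
    Differentiable ℂ fun s : ℂ => ∑' j : ℕ, (-s) ^ j / j.factorial * (x j : ℂ) := by
  intro s
  have hU : Metric.ball 0 (‖s‖ + 1) ∈ 𝓝 s := Metric.isOpen_ball.mem_nhds (by simp)
  refine DifferentiableOn.differentiableAt (differentiableOn_tsum_of_summable_norm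
    (summable_majorant R (‖s‖ + 1)) (fun j => ?_) Metric.isOpen_ball
    fun j z hz => norm_term_le hx (mem_ball_zero_iff.1 hz).le j) hU
  fun_prop

/-- The entire function `s ↦ ∑_j x_j (-s)^j / j!`. -/
def entireSeries (R : ℝ) (x : coeffBox R) : realEntire where
  val := ⟨fun s => ∑' j : ℕ, (-s) ^ j / j.factorial * (x.1 j : ℂ),
    (differentiable_series x.2).continuous⟩
  property := by
    refine ⟨differentiable_series x.2, fun t => ?_⟩
    have : ∑' j : ℕ, (-(t : ℂ)) ^ j / j.factorial * (x.1 j : ℂ)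
        = ((∑' j : ℕ, (-t) ^ j / j.factorial * x.1 j : ℝ) : ℂ) := by
      push_cast
      rfl
    simp only [ContinuousMap.coe_mk]
    rw [this, ofReal_im]

/-- The box is compact by Tychonoff, and joint continuity in coefficients and `s` curries to
continuity into the compact-open topology. -/
theorem isCompact_range_entireSeries (R : ℝ) : IsCompact (Set.range (entireSeries R)) := by
  have : CompactSpace (coeffBox R) := isCompact_iff_compactSpace.1 (isCompact_coeffBox R)
  refine isCompact_range
    (Continuous.subtype_mk (ContinuousMap.continuous_of_continuous_uncurry _ ?_) _)
  exact continuous_uncurry_series R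

/-- The Taylor coefficients of `entirePath n u` with respect to the monomials `(-s)^j / j!`. -/
def pathCoeff (n : ℕ) (u : ℕ → ℝ) (j : ℕ) : ℝ :=
  (√n)⁻¹ * (∑ k ∈ Finset.range n, u k ^ j - n * (1 / (j + 1)))

theorem entirePath_mem_range {R : ℝ} {n : ℕ} {u : ℕ → ℝ} (h : pathCoeff n u ∈ coeffBox R) :
    entirePath n u ∈ Set.range (entireSeries R) := by
  refine ⟨⟨_, h⟩, Subtype.ext (ContinuousMap.ext fun s => ?_)⟩
  refine HasSum.tsum_eq ?_
  rw [entirePath_apply, div_eq_inv_mul]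
  have := ((hasSum_sum fun k (_ : k ∈ Finset.range n) => hasSum_exp_neg_mul s (u k)).sub
    ((hasSum_Mc s).mul_left (n : ℂ))).mul_left (√n : ℂ)⁻¹
  refine this.congr_fun fun j => ?_
  simp only [pathCoeff]
  push_cast
  rw [← Finset.mul_sum]
  ring

end PowerSeries

/-! ### Central limit theorem for functions of the sample, and tightness. -/

section UniformSample

/-- The uniform distribution on `[0, 1]`. -/
def unif : Measure ℝ := volume.restrict (Set.Icc 0 1)

instance : IsProbabilityMeasure unif := ⟨by simp [unif]⟩

theorem integral_unif {E : Type*} [NormedAddCommGroup E] [NormedSpace ℝ E] (g : ℝ → E) :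
    ∫ u, g u ∂unif = ∫ u in (0 : ℝ)..1, g u := by
  rw [unif, integral_Icc_eq_integral_Ioc, intervalIntegral.integral_of_le zero_le_one]

theorem memLp_unif {E : Type*} [NormedAddCommGroup E] [SecondCountableTopologyEither ℝ E]
    {g : ℝ → E} (hg : Continuous g) (p : ENNReal) :
    MemLp g p unif := by
  obtain ⟨C, hC⟩ := isCompact_Icc.exists_bound_of_continuousOn (s := Set.Icc (0 : ℝ) 1)
    hg.continuousOn
  refine MemLp.of_bound hg.aestronglyMeasurable C ?_
  exact (ae_restrict_iff' measurableSet_Icc).2 (ae_of_all _ hC)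

variable {Ω : Type*} [MeasurableSpace Ω] {P : Measure Ω} {U : ℕ → Ω → ℝ}

theorem hasLaw_unif_of_isUniform {X : Ω → ℝ} (hX : pdf.IsUniform X (Set.Icc (0 : ℝ) 1) P volume) :
    HasLaw X unif P where
  aemeasurable := hX.aemeasurable (by simp) (by simp)
  map_eq := by
    rw [hX, ProbabilityTheory.cond, unif]
    simp

theorem aemeasurable_entirePath (hU : ∀ k, HasLaw (U k) unif P) (n : ℕ) :
    AEMeasurable (fun ω => entirePath n fun k => U k ω) P :=
  (continuous_entirePath n).measurable.comp_aemeasurable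
    (aemeasurable_pi_lambda _ fun k => (hU k).aemeasurable)

variable [IsProbabilityMeasure P]

theorem tendstoInDistribution_sample (hind : iIndepFun U P) (hU : ∀ k, HasLaw (U k) unif P)
    {g : ℝ → ℝ} (hg : Continuous g) :
    TendstoInDistribution
      (fun (n : ℕ) ω => (√n)⁻¹ * (∑ k ∈ Finset.range n, g (U k ω) - n * ∫ u, g u ∂unif)) atTop id
      (fun _ => P) (gaussianReal 0 Var[g; unif].toNNReal) := by
  have hV : Var[g ∘ U 0; P] = Var[g; unif] := by
    rw [← (hU 0).map_eq, variance_map hg.aemeasurable (hU 0).aemeasurable]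
  have hm : ∫ ω, (g ∘ U 0) ω ∂P = ∫ u, g u ∂unif := by
    rw [← (hU 0).map_eq, integral_map (hU 0).aemeasurable hg.aestronglyMeasurable]
    rfl
  have := tendstoInDistribution_inv_sqrt_mul_sum_sub (P := P) (X := fun k => g ∘ U k)
    (P' := gaussianReal 0 Var[g; unif].toNNReal) (Y := id) (by rw [hV]; exact HasLaw.id)
    ?_ (hind.comp _ fun _ => hg.measurable) fun k => ?_
  · rw [hm] at this
    exact this
  · have h2 := memLp_unif hg 2
    rw [← (hU 0).map_eq] at h2
    exact h2.comp_of_map (hU 0).aemeasurable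
  · exact (IdentDistrib.mk (hU k).aemeasurable (hU 0).aemeasurable
      ((hU k).map_eq.trans (hU 0).map_eq.symm)).comp hg.measurable

/-- Chebyshev; the bound is uniform in `n` and `j` because the variance of `U_k ^ j` is at most its
second moment `1 / (2j + 1) ≤ 1`. -/
theorem measure_pathCoeff_ge_le (hind : iIndepFun U P) (hU : ∀ k, HasLaw (U k) unif P)
    (n j : ℕ) {c : ℝ} (hc : 0 < c) :
    P {ω | c ≤ |pathCoeff n (fun k => U k ω) j|} ≤ ENNReal.ofReal (1 / c ^ 2) := by
  have hg : Continuous fun u : ℝ => u ^ j := by fun_prop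
  have hLp k : MemLp (fun ω => U k ω ^ j) 2 P := by
    have h2 := memLp_unif hg 2
    rw [← (hU k).map_eq] at h2
    exact h2.comp_of_map (hU k).aemeasurable
  have hmean k : ∫ ω, U k ω ^ j ∂P = 1 / (j + 1) := by
    have := integral_map (hU k).aemeasurable (hg.aestronglyMeasurable (μ := P.map (U k)))
    rw [← this, (hU k).map_eq, integral_unif, integral_pow]
    simp
  have hvar k : Var[fun ω => U k ω ^ j; P] ≤ 1 := by
    refine (variance_le_expectation_sq (hLp k).1).trans ?_
    have := integral_map (hU k).aemeasurable
      (Continuous.aestronglyMeasurable (f := fun u : ℝ => (u ^ j) ^ 2) (by fun_prop)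
        (μ := P.map (U k)))
    simp only [Pi.pow_apply]
    rw [← this, (hU k).map_eq, integral_unif]
    simp only [← pow_mul]
    rw [integral_pow]
    simp only [one_pow, ne_eq, Nat.add_eq_zero_iff, one_ne_zero, and_false, not_false_eq_true,
      zero_pow, sub_zero]
    rw [div_le_one (by positivity)]
    norm_cast
    omega
  set S : Ω → ℝ := ∑ k ∈ Finset.range n, fun ω => U k ω ^ j with hS
  have hSapp ω : S ω = ∑ k ∈ Finset.range n, U k ω ^ j := by simp [hS]
  have hSLp : MemLp S 2 P := memLp_finsetSum' _ fun k _ => hLp k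
  have hSmean : ∫ ω, S ω ∂P = n * (1 / (j + 1)) := by
    simp only [hSapp]
    rw [integral_finsetSum _ fun k _ => (hLp k).integrable one_le_two]
    simp [hmean]
  have hSvar : Var[S; P] ≤ n := by
    rw [IndepFun.variance_sum (fun k _ => hLp k) fun i _ k _ hik =>
      (hind.indepFun hik).comp hg.measurable hg.measurable]
    refine (Finset.sum_le_sum fun k _ => hvar k).trans ?_
    simp
  have hX : MemLp (fun ω => (√n)⁻¹ * S ω) 2 P := hSLp.const_mul _
  have hXvar : Var[fun ω => (√n)⁻¹ * S ω; P] ≤ 1 := by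
    rw [variance_const_mul, inv_pow, Real.sq_sqrt (by positivity)]
    calc (n : ℝ)⁻¹ * Var[S; P] ≤ (n : ℝ)⁻¹ * n := by gcongr
      -- An inequality rather than an equality, since `0⁻¹ * 0 = 0` when `n = 0`.
      _ ≤ 1 := inv_mul_le_one
  have := meas_ge_le_variance_div_sq hX hc
  rw [integral_const_mul, hSmean] at this
  simp only [hSapp, ← mul_sub] at this
  refine this.trans (ENNReal.ofReal_le_ofReal ?_)
  simp only [hSapp] at hXvar
  gcongr

/-- A union bound over `j`: the threshold `R 2^j` is exceeded with probability at most `R⁻² 4^{-j}`,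
whose sum tends to 0 as `R` grows, uniformly in `n`. -/
theorem isTightMeasureSet_entirePath (hind : iIndepFun U P) (hU : ∀ k, HasLaw (U k) unif P) :
    IsTightMeasureSet (Set.range fun n => P.map fun ω => entirePath n fun k => U k ω) := by
  rw [isTightMeasureSet_iff_exists_isCompact_measure_compl_le]
  intro ε hε
  have hbound (R : ℝ) (hR : 0 < R) (n : ℕ) :
      P.map (fun ω => entirePath n fun k => U k ω) (Set.range (entireSeries R))ᶜ
        ≤ ENNReal.ofReal (R⁻¹ ^ 2 * ∑' j : ℕ, (1 / 4 : ℝ) ^ j) := by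
    rw [Measure.map_apply_of_aemeasurable (aemeasurable_entirePath hU n)
      (isCompact_range_entireSeries R).measurableSet.compl]
    have hsub : (fun ω => entirePath n fun k => U k ω) ⁻¹' (Set.range (entireSeries R))ᶜ ⊆
        ⋃ j, {ω | R * 2 ^ j ≤ |pathCoeff n (fun k => U k ω) j|} := by
      intro ω hω
      by_contra h
      simp only [Set.mem_iUnion, Set.mem_ofPred_eq, not_exists, not_le] at h
      exact hω (entirePath_mem_range fun j _ => abs_le.1 (h j).le)
    refine (measure_mono hsub).trans ((measure_iUnion_le _).trans ?_)
    rw [← tsum_mul_left, ENNReal.ofReal_tsum_of_nonneg (fun j => by positivity)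
      ((summable_geometric_of_lt_one (by norm_num) (by norm_num)).mul_left _)]
    refine ENNReal.tsum_le_tsum fun j =>
      (measure_pathCoeff_ge_le hind hU n j (by positivity)).trans (le_of_eq ?_)
    congr 1
    rw [mul_pow, ← pow_mul, mul_comm j, pow_mul, one_div_pow]
    norm_num
    ring
  have hlim : Tendsto (fun R : ℝ => ENNReal.ofReal (R⁻¹ ^ 2 * ∑' j : ℕ, (1 / 4 : ℝ) ^ j)) atTop
      (𝓝 0) := by
    rw [← ENNReal.ofReal_zero]
    refine (ENNReal.continuous_ofReal.tendsto 0).comp ?_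
    simpa using (tendsto_inv_atTop_zero.pow 2).mul_const (∑' j : ℕ, (1 / 4 : ℝ) ^ j)
  obtain ⟨R, hRε, hR⟩ := ((hlim.eventually_le_const hε).and (eventually_gt_atTop 0)).exists
  refine ⟨_, isCompact_range_entireSeries R, ?_⟩
  rintro _ ⟨n, rfl⟩
  exact (hbound R hR n).trans hRε

end UniformSample

/-! ### Limit points of the laws of the entire paths. -/

section Convergence

variable {Ω : Type*} [MeasurableSpace Ω] {P : Measure Ω} [IsProbabilityMeasure P] {U : ℕ → Ω → ℝ}

theorem continuous_functional {ι : Type*} [Fintype ι] (p : ι → ℂ) (Λ : (ι → ℂ) →L[ℝ] ℝ) :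
    Continuous fun f : realEntire => Λ fun i => f.1 (p i) :=
  Λ.continuous.comp (continuous_pi fun i =>
    (continuous_eval_const (p i)).comp continuous_subtype_val)

theorem continuous_exp_functional {ι : Type*} [Fintype ι] (p : ι → ℂ) (Λ : (ι → ℂ) →L[ℝ] ℝ) :
    Continuous fun u : ℝ => Λ fun i => exp (-(p i * u)) := by
  fun_prop

theorem integral_exp_unif (s : ℂ) : ∫ u, exp (-(s * u)) ∂unif = Mc s := by
  rw [integral_unif, Mc_eq_integral]

theorem integral_functional_unif {ι : Type*} [Fintype ι] (p : ι → ℂ) (Λ : (ι → ℂ) →L[ℝ] ℝ) :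
    ∫ u, Λ (fun i => exp (-(p i * u))) ∂unif = Λ fun i => Mc (p i) := by
  have hint : ∀ i, Integrable (fun u : ℝ => exp (-(p i * u))) unif := fun i =>
    memLp_one_iff_integrable.1 (memLp_unif (by fun_prop) 1)
  rw [Λ.integral_comp_comm (Integrable.of_eval hint)]
  congr 1
  funext i
  rw [eval_integral hint, integral_exp_unif]

theorem functional_entirePath {ι : Type*} [Fintype ι] (p : ι → ℂ) (Λ : (ι → ℂ) →L[ℝ] ℝ)
    (n : ℕ) (u : ℕ → ℝ) :
    Λ (fun i => (entirePath n u).1 (p i)) = (√n)⁻¹ *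
      (∑ k ∈ Finset.range n, Λ (fun i => exp (-(p i * u k))) - n * Λ fun i => Mc (p i)) := by
  have : (fun i => (entirePath n u).1 (p i)) = (√n)⁻¹ •
      (∑ k ∈ Finset.range n, (fun i => exp (-(p i * u k))) - (n : ℝ) • fun i => Mc (p i)) := by
    funext i
    simp [entirePath_apply, div_eq_inv_mul]
  rw [this]
  simp

/-- The joint laws of real linear functionals of the values of the complex process converge. -/
theorem tendstoInDistribution_functional (hind : iIndepFun U P) (hU : ∀ k, HasLaw (U k) unif P)
    {ι : Type*} [Fintype ι] (p : ι → ℂ) (Λ : (ι → ℂ) →L[ℝ] ℝ) :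
    TendstoInDistribution (fun n ω => Λ fun i => (entirePath n fun k => U k ω).1 (p i)) atTop id
      (fun _ => P)
      (gaussianReal 0 Var[fun u : ℝ => Λ fun i => exp (-(p i * u)); unif].toNNReal) := by
  have := tendstoInDistribution_sample hind hU (continuous_exp_functional p Λ)
  simp only [integral_functional_unif, ← functional_entirePath] at this
  exact this

/-- The law of the complex process. -/
def pathLaw (hU : ∀ k, HasLaw (U k) unif P) (n : ℕ) : ProbabilityMeasure realEntire :=
  ⟨P.map fun ω => entirePath n fun k => U k ω,
    Measure.isProbabilityMeasure_map (aemeasurable_entirePath hU n)⟩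

/-- Prokhorov's theorem; an ultrafilter finer than `atTop` plays the role of a convergent
subsequence. -/
theorem exists_ultrafilter_tendsto_pathLaw (hind : iIndepFun U P)
    (hU : ∀ k, HasLaw (U k) unif P) :
    ∃ (F : Ultrafilter ℕ) (μ : ProbabilityMeasure realEntire),
      (F : Filter ℕ) ≤ atTop ∧ Tendsto (pathLaw hU) F (𝓝 μ) := by
  have hc : IsCompact (closure (Set.range (pathLaw hU))) := by
    refine isCompact_closure_of_isTightMeasureSet ((isTightMeasureSet_entirePath hind hU).subset ?_)
    rintro _ ⟨_, ⟨n, rfl⟩, rfl⟩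
    exact ⟨n, rfl⟩
  let F : Ultrafilter ℕ := Ultrafilter.of atTop
  have hmem : Set.range (pathLaw hU) ∈ F.map (pathLaw hU) :=
    Ultrafilter.mem_map.2 (univ_mem' fun n => ⟨n, rfl⟩)
  obtain ⟨μ, -, hμ⟩ := hc.ultrafilter_le_nhds (F.map (pathLaw hU))
    (le_principal_iff.2 (mem_of_superset hmem subset_closure))
  exact ⟨F, μ, Ultrafilter.of_le _, hμ⟩

/-- A probability measure on real entire functions under which the values are centred Gaussian
with the covariances of the functions `u ↦ e^{-su}` under the uniform law. -/
def IsLimitLaw (μ : Measure realEntire) : Prop :=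
  ∀ (ι : Type) [Fintype ι] (p : ι → ℂ) (Λ : (ι → ℂ) →L[ℝ] ℝ),
    HasLaw (fun f : realEntire => Λ fun i => f.1 (p i))
      (gaussianReal 0 Var[fun u : ℝ => Λ fun i => exp (-(p i * u)); unif].toNNReal) μ

/-- Along `F`, the law of each functional tends both to its law under `μ` (continuous mapping) and
to the Gaussian of the central limit theorem; limits are unique. -/
theorem isLimitLaw_of_tendsto (hind : iIndepFun U P) (hU : ∀ k, HasLaw (U k) unif P)
    {F : Ultrafilter ℕ} {μ : ProbabilityMeasure realEntire} (hF : (F : Filter ℕ) ≤ atTop)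
    (hμ : Tendsto (pathLaw hU) F (𝓝 μ)) : IsLimitLaw μ := by
  intro ι _ p Λ
  have hcont := continuous_functional p Λ
  refine ⟨hcont.aemeasurable, ?_⟩
  have h1 := (tendstoInDistribution_functional hind hU p Λ).tendsto.mono_left hF
  have h2 := ProbabilityMeasure.tendsto_map_of_tendsto_of_continuous _ _ hμ hcont
  have h3 : Tendsto (fun n => (pathLaw hU n).map hcont.aemeasurable) F
      (𝓝 (⟨(gaussianReal 0 Var[fun u : ℝ => Λ fun i => exp (-(p i * u)); unif].toNNReal).map id,
        Measure.isProbabilityMeasure_map aemeasurable_id⟩ : ProbabilityMeasure ℝ)) := by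
    refine h1.congr fun n => Subtype.ext ?_
    exact (AEMeasurable.map_map_of_aemeasurable hcont.aemeasurable
      (aemeasurable_entirePath hU n)).symm
  have h4 := congrArg (fun ν : ProbabilityMeasure ℝ => (ν : Measure ℝ)) (tendsto_nhds_unique h2 h3)
  simpa using h4

end Convergence

/-! ### Gaussianity and covariance of the limit law. -/

section LimitLaw

/-- Reduces the unconjugated complex covariance to four real ones, so that equality of real
covariances under `μ` and `unif` carries over to complex values. -/
theorem integral_mul_sub_eq_covariance {Ω : Type*} [MeasurableSpace Ω] {Q : Measure Ω}
    [IsProbabilityMeasure Q] {X Y : Ω → ℂ} (hX : MemLp X 2 Q) (hY : MemLp Y 2 Q) :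
    ∫ ω, X ω * Y ω ∂Q - (∫ ω, X ω ∂Q) * ∫ ω, Y ω ∂Q =
      (cov[fun ω => (X ω).re, fun ω => (Y ω).re; Q]
        - cov[fun ω => (X ω).im, fun ω => (Y ω).im; Q] : ℝ)
      + (cov[fun ω => (X ω).re, fun ω => (Y ω).im; Q]
        + cov[fun ω => (X ω).im, fun ω => (Y ω).re; Q] : ℝ) * I := by
  have hXr := hX.re
  have hXi := hX.im
  have hYr := hY.re
  have hYi := hY.im
  simp only [RCLike.re_to_complex, RCLike.im_to_complex] at hXr hXi hYr hYi
  have i1 := hX.integrable one_le_two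
  have i2 := hY.integrable one_le_two
  have i3 : Integrable (fun ω => X ω * Y ω) Q := hX.integrable_mul hY
  rw [covariance_eq_sub hXr hYr, covariance_eq_sub hXi hYi, covariance_eq_sub hXr hYi,
    covariance_eq_sub hXi hYr]
  have e1 : ∫ ω, (X ω).re * (Y ω).re ∂Q - ∫ ω, (X ω).im * (Y ω).im ∂Q
      = (∫ ω, X ω * Y ω ∂Q).re := by
    exact (integral_sub (hXr.integrable_mul hYr) (hXi.integrable_mul hYi)).symm.trans
      (integral_re i3)
  have e2 : ∫ ω, (X ω).re * (Y ω).im ∂Q + ∫ ω, (X ω).im * (Y ω).re ∂Q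
      = (∫ ω, X ω * Y ω ∂Q).im := by
    exact (integral_add (hXr.integrable_mul hYi) (hXi.integrable_mul hYr)).symm.trans
      (integral_im i3)
  have eXr : ∫ ω, (X ω).re ∂Q = (∫ ω, X ω ∂Q).re := integral_re i1
  have eXi : ∫ ω, (X ω).im ∂Q = (∫ ω, X ω ∂Q).im := integral_im i1
  have eYr : ∫ ω, (Y ω).re ∂Q = (∫ ω, Y ω ∂Q).re := integral_re i2
  have eYi : ∫ ω, (Y ω).im ∂Q = (∫ ω, Y ω ∂Q).im := integral_im i2
  simp only [Pi.mul_apply]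
  apply Complex.ext
  · simp only [sub_re, mul_re, add_re, ofReal_re, ofReal_im, I_re, I_im, eXr, eXi, eYr, eYi, ← e1]
    ring
  · simp only [sub_im, mul_im, add_im, ofReal_re, ofReal_im, I_re, I_im, eXr, eXi, eYr, eYi, ← e2]
    ring

variable {μ : Measure realEntire}

theorem IsLimitLaw.memLp_functional (h : IsLimitLaw μ) {ι : Type} [Fintype ι] (p : ι → ℂ)
    (Λ : (ι → ℂ) →L[ℝ] ℝ) : MemLp (fun f : realEntire => Λ fun i => f.1 (p i)) 2 μ := by
  have := memLp_id_gaussianReal (μ := 0)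
    (v := Var[fun u : ℝ => Λ fun i => exp (-(p i * u)); unif].toNNReal) 2
  rw [← (h ι p Λ).map_eq] at this
  exact this.comp_of_map (h ι p Λ).aemeasurable

theorem IsLimitLaw.integral_functional (h : IsLimitLaw μ) {ι : Type} [Fintype ι] (p : ι → ℂ)
    (Λ : (ι → ℂ) →L[ℝ] ℝ) : ∫ f : realEntire, Λ (fun i => f.1 (p i)) ∂μ = 0 := by
  have := (h ι p Λ).integral_eq
  simpa using this

theorem IsLimitLaw.variance_functional (h : IsLimitLaw μ) {ι : Type} [Fintype ι] (p : ι → ℂ)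
    (Λ : (ι → ℂ) →L[ℝ] ℝ) : Var[fun f : realEntire => Λ fun i => f.1 (p i); μ] =
      Var[fun u : ℝ => Λ fun i => exp (-(p i * u)); unif] := by
  rw [(h ι p Λ).variance_eq, variance_id_gaussianReal, Real.coe_toNNReal _ (variance_nonneg _ _)]

theorem IsLimitLaw.isProbabilityMeasure (h : IsLimitLaw μ) : IsProbabilityMeasure μ := by
  -- Even with no evaluation points the pushforward of `μ` is a Gaussian law, so `μ` has total mass
  -- 1.
  have h0 := h Empty (fun _ => 0) 0
  exact h0.isProbabilityMeasure_iff.2 inferInstance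

/-- Polarisation of the variance identity, applied to `Λ₁ + Λ₂`. -/
theorem IsLimitLaw.covariance_functional (h : IsLimitLaw μ) {ι : Type} [Fintype ι] (p : ι → ℂ)
    (Λ₁ Λ₂ : (ι → ℂ) →L[ℝ] ℝ) :
    cov[fun f : realEntire => Λ₁ fun i => f.1 (p i),
        fun f : realEntire => Λ₂ fun i => f.1 (p i); μ] =
      cov[fun u : ℝ => Λ₁ fun i => exp (-(p i * u)),
        fun u : ℝ => Λ₂ fun i => exp (-(p i * u)); unif] := by
  have := h.isProbabilityMeasure
  have h1 := h.variance_functional p (Λ₁ + Λ₂)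
  simp only [add_apply] at h1
  rw [variance_fun_add (h.memLp_functional p Λ₁) (h.memLp_functional p Λ₂),
    variance_fun_add (memLp_unif (continuous_exp_functional p Λ₁) 2)
      (memLp_unif (continuous_exp_functional p Λ₂) 2),
    h.variance_functional p Λ₁, h.variance_functional p Λ₂] at h1
  linarith

theorem IsLimitLaw.memLp_eval (h : IsLimitLaw μ) (s : ℂ) :
    MemLp (fun f : realEntire => f.1 s) 2 μ := by
  refine memLp_re_im_iff.1 ⟨?_, ?_⟩
  · exact h.memLp_functional (fun _ : Unit => s) (reCLM.comp (ContinuousLinearMap.proj ()))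
  · exact h.memLp_functional (fun _ : Unit => s) (imCLM.comp (ContinuousLinearMap.proj ()))

theorem IsLimitLaw.isCentredGaussianC (h : IsLimitLaw μ) :
    IsCentredGaussianC (fun s (f : realEntire) => f.1 s) covc μ := by
  have := h.isProbabilityMeasure
  have hmean s : ∫ f : realEntire, f.1 s ∂μ = 0 := by
    have hint := (h.memLp_eval s).integrable one_le_two
    apply Complex.ext
    · rw [← RCLike.re_to_complex, ← integral_re hint]
      exact h.integral_functional (fun _ : Unit => s) (reCLM.comp (ContinuousLinearMap.proj ()))
    · rw [← RCLike.im_to_complex, ← integral_im hint]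
      exact h.integral_functional (fun _ : Unit => s) (imCLM.comp (ContinuousLinearMap.proj ()))
  refine ⟨⟨fun I => ⟨?_⟩⟩, hmean, fun s w => ?_⟩
  · have hmeas : Measurable fun f : realEntire => I.restrict fun s => f.1 s :=
      measurable_pi_lambda _ fun i =>
        ((continuous_eval_const (i : ℂ)).comp continuous_subtype_val).measurable
    -- A finite-dimensional law is Gaussian once all its real linear functionals are.
    refine isGaussian_of_map_eq_gaussianReal fun Λ => ⟨0, _,
      (Measure.map_map Λ.continuous.measurable hmeas).trans (h I (fun i => i) Λ).map_eq⟩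
  · have hcov (Λ₁ Λ₂ : ℂ →L[ℝ] ℝ) := h.covariance_functional ![s, w]
      (Λ₁.comp (ContinuousLinearMap.proj 0)) (Λ₂.comp (ContinuousLinearMap.proj 1))
    simp only [ContinuousLinearMap.comp_apply, ContinuousLinearMap.proj_apply, Matrix.cons_val_zero,
      Matrix.cons_val_one] at hcov
    have e1 := integral_mul_sub_eq_covariance (h.memLp_eval s) (h.memLp_eval w)
    have e2 := integral_mul_sub_eq_covariance (Q := unif) (X := fun u : ℝ => exp (-(s * u)))
      (Y := fun u : ℝ => exp (-(w * u))) (memLp_unif (by fun_prop) 2) (memLp_unif (by fun_prop) 2)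
    have c1 := hcov reCLM reCLM
    have c2 := hcov imCLM imCLM
    have c3 := hcov reCLM imCLM
    have c4 := hcov imCLM reCLM
    simp only [reCLM_apply, imCLM_apply] at c1 c2 c3 c4
    rw [c1, c2, c3, c4, ← e2, hmean, zero_mul, sub_zero] at e1
    rw [e1, integral_exp_unif, integral_exp_unif, covc, ← integral_exp_unif (s + w)]
    congr 2
    funext u
    rw [← Complex.exp_add]
    congr 1
    ring

theorem IsLimitLaw.isCentredGaussian (h : IsLimitLaw μ) :
    IsCentredGaussian (fun s (f : realEntire) => restrictReal f s) cov μ := by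
  have hc := h.isCentredGaussianC
  refine ⟨?_, fun s => ?_, fun s w => ?_⟩
  · exact (hc.gaussian.comp_right (fun x : ℝ => (x : ℂ))).comp_left fun _ => reCLM
  · apply ofReal_injective
    rw [← integral_complex_ofReal]
    simp only [ofReal_restrictReal, hc.mean, ofReal_zero]
  · apply ofReal_injective
    rw [← integral_complex_ofReal, ← covc_ofReal, ← hc.covariance]
    simp only [ofReal_mul, ofReal_restrictReal]

end LimitLaw

/-! ### Weak convergence from tightness and one-dimensional laws. -/

/-- A tight family of laws on a Polish vector space converges weakly as soon as the laws of
a point-separating vector space of continuous functionals do. -/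
theorem tendsto_of_tight_of_tendsto_map {E W : Type*} [AddCommGroup E] [Module ℝ E]
    [TopologicalSpace E] [PolishSpace E] [MeasurableSpace E] [BorelSpace E] [AddCommGroup W]
    [Module ℝ W] (L : E →ₗ[ℝ] W →ₗ[ℝ] ℝ) (hL : ∀ w, Continuous fun v => L v w)
    (hL' : ∀ v ≠ 0, L v ≠ 0) {ι : Type*} {F : Filter ι} {ν : ι → ProbabilityMeasure E}
    {ν₀ : ProbabilityMeasure E} (ht : IsTightMeasureSet {(ν n : Measure E) | n})
    (h : ∀ w, Tendsto (fun n => (ν n).map (hL w).aemeasurable) F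
      (𝓝 (ν₀.map (hL w).aemeasurable))) :
    Tendsto ν F (𝓝 ν₀) := by
  -- With `W` discrete, continuity of the pairing in its first variable is already joint continuity.
  let _ : TopologicalSpace W := ⊥
  have : DiscreteTopology W := ⟨rfl⟩
  have hLc : Continuous fun q : E × W => L q.1 q.2 := continuous_prod_of_discrete_right.2 hL
  refine ProbabilityMeasure.tendsto_of_tight_of_separatesPoints ℂ ht
    (A := BoundedContinuousFunction.charPoly Real.continuous_probChar hLc)
    (BoundedContinuousFunction.separatesPoints_charPoly _
      Real.probChar_ne_one hLc hL') fun g hg => ?_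
  rw [BoundedContinuousFunction.mem_charPoly] at hg
  obtain ⟨w, hw⟩ := hg
  -- A test function is a finite combination of characters `v ↦ exp (i L v a)`, so its integral
  -- depends only on the laws of the functionals `L · a`.
  have hsum (μ : ProbabilityMeasure E) : ∫ v, g v ∂(μ : Measure E) =
      w.coeff.sum fun a z => z * ∫ x, BoundedContinuousFunction.innerProbChar (1 : ℝ) x
        ∂(μ.map (hL a).aemeasurable : Measure ℝ) := by
    rw [hw]
    simp only [Finsupp.sum]
    refine (integral_finsetSum _ fun a _ => ((BoundedContinuousFunction.char
      Real.continuous_probChar hLc a).integrable (μ : Measure E)).const_mul _).trans ?_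
    refine Finset.sum_congr rfl fun a _ => ?_
    rw [integral_const_mul, ProbabilityMeasure.toMeasure_map,
      integral_map (hL a).aemeasurable
        (BoundedContinuousFunction.innerProbChar (1 : ℝ)).continuous.aestronglyMeasurable]
    congr 2
    funext v
    simp [BoundedContinuousFunction.innerProbChar_apply, Real.probChar_apply]
  simp only [hsum]
  refine tendsto_finsetSum _ fun a _ => Tendsto.const_mul _ ?_
  exact (ProbabilityMeasure.tendsto_iff_forall_integral_rclike_tendsto ℂ).1 (h a) _

/-- The law involves only `K`: this is how two realisations on different probability spaces are
compared. -/
theorem IsCentredGaussian.hasLaw_sum {Ω T : Type*} [MeasurableSpace Ω] {X : T → Ω → ℝ}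
    {K : T → T → ℝ} {Q : Measure Ω} (h : IsCentredGaussian X K Q) (I : Finset T) (c : I → ℝ) :
    HasLaw (fun ω => ∑ i, c i * X i ω)
      (gaussianReal 0 (∑ i, ∑ j, c i * c j * K i j).toNNReal) Q := by
  have hg : HasGaussianLaw (fun ω => ∑ i, c i * X i ω) Q := by
    have := (h.gaussian.hasGaussianLaw I).map_fun
      (∑ i, c i • (ContinuousLinearMap.proj i : (I → ℝ) →L[ℝ] ℝ))
    simpa using this
  have := hg.isProbabilityMeasure
  have hLp i : MemLp (X i) 2 Q := (h.gaussian.hasGaussianLaw_eval i).memLp_two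
  have hmean : ∫ ω, ∑ i, c i * X i ω ∂Q = 0 := by
    rw [integral_finsetSum _ fun (i : I) _ => ((hLp i).integrable one_le_two).const_mul (c i)]
    simp [integral_const_mul, h.mean]
  have hvar : Var[fun ω => ∑ i, c i * X i ω; Q] = ∑ i, ∑ j, c i * c j * K i j := by
    rw [variance_of_integral_eq_zero hg.aemeasurable hmean]
    have e (ω : Ω) : (∑ i, c i * X i ω) ^ 2 = ∑ i, ∑ j, c i * c j * (X i ω * X j ω) := by
      rw [sq, Finset.sum_mul_sum]
      exact Finset.sum_congr rfl fun i _ => Finset.sum_congr rfl fun j _ => by ring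
    have hint (i j : I) : Integrable (fun ω => c i * c j * (X i ω * X j ω)) Q :=
      ((hLp i).integrable_mul (hLp j)).const_mul _
    simp only [e]
    rw [integral_finsetSum _ fun i _ => integrable_finsetSum _ fun j _ => hint i j]
    refine Finset.sum_congr rfl fun i _ => ?_
    rw [integral_finsetSum _ fun j _ => hint i j]
    exact Finset.sum_congr rfl fun j _ => by rw [integral_const_mul, h.covariance]
  refine ⟨hg.aemeasurable, ?_⟩
  rw [hg.isGaussian_map.eq_gaussianReal, variance_id_map hg.aemeasurable, hvar,
    integral_map hg.aemeasurable aestronglyMeasurable_id]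
  simp only [id, hmean]

/-- The pairing `(f, w) ↦ ∑_s w(s) f(s)` of continuous functions with finitely supported weights. -/
def evalPairing : C(ℝ, ℝ) →ₗ[ℝ] (ℝ →₀ ℝ) →ₗ[ℝ] ℝ :=
  LinearMap.mk₂ ℝ (fun f w => w.sum fun s c => c * f s)
    (fun f g w => by simp [mul_add])
    (fun c f w => by simp [Finsupp.mul_sum, mul_left_comm])
    (fun f v w => Finsupp.sum_add_index' (by simp) (by intros; ring))
    (fun c f w => by
      rw [Finsupp.sum_smul_index' (by simp)]
      simp [Finsupp.mul_sum, mul_assoc])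

theorem evalPairing_apply (f : C(ℝ, ℝ)) (w : ℝ →₀ ℝ) :
    evalPairing f w = ∑ s : w.support, w s * f s :=
  (Finset.sum_coe_sort w.support fun s => w s * f s).symm

theorem continuous_evalPairing (w : ℝ →₀ ℝ) : Continuous fun f => evalPairing f w := by
  simp only [evalPairing_apply]
  exact continuous_finsetSum _ fun s _ => continuous_const.mul (continuous_eval_const _)

theorem evalPairing_ne_zero (f : C(ℝ, ℝ)) (hf : f ≠ 0) : evalPairing f ≠ 0 := by
  contrapose! hf
  ext s
  have h : (Finsupp.single s 1).sum (fun s c => c * f s) = 0 := LinearMap.congr_fun hf _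
  rwa [Finsupp.sum_single_index (zero_mul _), one_mul] at h

/-! ### Convergence in `C(ℝ, ℝ)` and holomorphic extension. -/

section Main

variable {Ω : Type*} [MeasurableSpace Ω] {P : Measure Ω} {U : ℕ → Ω → ℝ}

theorem aemeasurable_scaledZn (hU : ∀ k, HasLaw (U k) unif P) (n : ℕ) :
    AEMeasurable (scaledZn U n) P := by
  have := continuous_restrictReal.measurable.comp_aemeasurable (aemeasurable_entirePath hU n)
  simpa only [Function.comp_def, restrictReal_entirePath] using this

/-- The weighted sum of real evaluations as a real linear functional of complex values. -/
def reSum (w : ℝ →₀ ℝ) : (w.support → ℂ) →L[ℝ] ℝ :=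
  ∑ s : w.support, w s • reCLM.comp (ContinuousLinearMap.proj s)

theorem reSum_eq_evalPairing (w : ℝ →₀ ℝ) (f : realEntire) :
    reSum w (fun s => f.1 (s : ℝ)) = evalPairing (restrictReal f) w := by
  simp [reSum, evalPairing_apply]

theorem integral_Zn (hU : ∀ k, HasLaw (U k) unif P) (n : ℕ) (s : ℝ) :
    ∫ ω, Zn U n s ω ∂P = n * M s := by
  have hc : Continuous fun u : ℝ => Real.exp (-(s * u)) := by fun_prop
  have hM : ∫ u, Real.exp (-(s * u)) ∂unif = M s := by
    apply ofReal_injective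
    rw [← integral_complex_ofReal, ← Mc_ofReal, ← integral_exp_unif]
    simp
  have hint k : Integrable (fun ω => Real.exp (-(s * U k ω))) P := by
    have := memLp_unif hc 1
    rw [← (hU k).map_eq] at this
    exact memLp_one_iff_integrable.1 (this.comp_of_map (hU k).aemeasurable)
  have hmean k : ∫ ω, Real.exp (-(s * U k ω)) ∂P = M s := by
    rw [← hM, ← (hU k).map_eq, integral_map (hU k).aemeasurable hc.aestronglyMeasurable]
  simp only [Zn]
  rw [integral_finsetSum _ fun k _ => hint k]
  simp [hmean]

variable [IsProbabilityMeasure P]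

theorem map_restrictReal_pathLaw (hU : ∀ k, HasLaw (U k) unif P) (n : ℕ) :
    (pathLaw hU n : Measure realEntire).map restrictReal = P.map (scaledZn U n) := by
  have := AEMeasurable.map_map_of_aemeasurable
    (continuous_restrictReal.aemeasurable (μ := P.map fun ω => entirePath n fun k => U k ω))
    (aemeasurable_entirePath hU n)
  simp only [Function.comp_def, restrictReal_entirePath] at this
  exact this

theorem tendstoInDistribution_scaledZn (hind : iIndepFun U P) (hU : ∀ k, HasLaw (U k) unif P)
    {μ : Measure realEntire} (hμ : IsLimitLaw μ)
    {Ω' : Type*} [MeasurableSpace Ω'] {Q : Measure Ω'} [IsProbabilityMeasure Q]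
    {Z : Ω' → C(ℝ, ℝ)} (hZm : AEMeasurable Z Q)
    (hZ : IsCentredGaussian (fun s ω => Z ω s) cov Q) :
    TendstoInDistribution (scaledZn U) atTop Z (fun _ => P) Q := by
  refine ⟨aemeasurable_scaledZn hU, hZm, ?_⟩
  refine tendsto_of_tight_of_tendsto_map evalPairing continuous_evalPairing evalPairing_ne_zero
    (((isTightMeasureSet_entirePath hind hU).map continuous_restrictReal).subset ?_) fun w => ?_
  · rintro _ ⟨n, rfl⟩
    exact ⟨_, ⟨n, rfl⟩, map_restrictReal_pathLaw hU n⟩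
  · have h1 := hμ w.support (fun s => (s : ℝ)) (reSum w)
    simp only [reSum_eq_evalPairing] at h1
    have h2 := hZ.hasLaw_sum w.support fun s => w s
    have h3 := hμ.isCentredGaussian.hasLaw_sum w.support fun s => w s
    simp only [← evalPairing_apply] at h2 h3
    have h4 := (tendstoInDistribution_functional hind hU (fun s : w.support => (s : ℝ))
      (reSum w)).tendsto
    simp only [reSum_eq_evalPairing, restrictReal_entirePath] at h4
    -- The variance from the central limit theorem is matched with the one given by `cov` through
    -- `μ`, for which both descriptions hold.
    have h5 : (Q.map Z).map (fun f => evalPairing f w) = (gaussianReal 0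
        Var[fun u : ℝ => reSum w fun i => exp (-((i : ℝ) * u)); unif].toNNReal).map id := by
      rw [Measure.map_id, ← h1.map_eq, h3.map_eq, ← h2.map_eq]
      exact AEMeasurable.map_map_of_aemeasurable (continuous_evalPairing w).aemeasurable hZm
    have h6 : ProbabilityMeasure.map
        ⟨Q.map Z, Measure.isProbabilityMeasure_map hZm⟩ (continuous_evalPairing w).aemeasurable =
        ⟨_, Measure.isProbabilityMeasure_map aemeasurable_id⟩ := Subtype.ext h5
    rw [h6]
    refine h4.congr fun n => Subtype.ext ?_
    exact (AEMeasurable.map_map_of_aemeasurable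
      (continuous_evalPairing w).aemeasurable (aemeasurable_scaledZn hU n)).symm

/-- Lusin–Souslin: an injective continuous map between Polish spaces is a measurable embedding. Off
the range the values of `Ψ` are irrelevant; `entirePath 0 0` only shows that the target is nonempty.
-/
theorem exists_measurable_leftInverse_restrictReal :
    ∃ Ψ : C(ℝ, ℝ) → realEntire, Measurable Ψ ∧ ∀ f, Ψ (restrictReal f) = f := by
  obtain ⟨Ψ, hΨ, h⟩ := (continuous_restrictReal.measurableEmbedding
    injective_restrictReal).exists_measurable_extend measurable_id fun _ => ⟨entirePath 0 0⟩
  exact ⟨Ψ, hΨ, congrFun h⟩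

theorem IsCentredGaussianC.comp {Ω' Ω'' T : Type*} [MeasurableSpace Ω'] [MeasurableSpace Ω'']
    {Q : Measure Ω'} {μ : Measure Ω''} {X : T → Ω'' → ℂ} {K : T → T → ℂ}
    (h : IsCentredGaussianC X K μ) (hX : ∀ t, Measurable (X t)) {Y : Ω' → Ω''}
    (hY : HasLaw Y μ Q) : IsCentredGaussianC (fun t ω => X t (Y ω)) K Q := by
  refine ⟨⟨fun I => ⟨?_⟩⟩, fun s => ?_, fun s w => ?_⟩
  · have hm : Measurable fun y => I.restrict (X · y) := measurable_pi_lambda _ fun i => hX i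
    have := (h.gaussian.hasGaussianLaw I).isGaussian_map
    rw [← hY.map_eq, AEMeasurable.map_map_of_aemeasurable hm.aemeasurable hY.aemeasurable] at this
    exact this
  · rw [← h.mean s, ← hY.map_eq,
      integral_map hY.aemeasurable (hX s).aestronglyMeasurable]
  · rw [← h.covariance s w, ← hY.map_eq]
    exact (integral_map hY.aemeasurable ((hX s).mul (hX w)).aestronglyMeasurable).symm

/-- The extension is `Ψ ∘ Z` for a measurable left inverse `Ψ` of restriction. It has law `μ`, and
it restricts to `Z` almost surely because `restrictReal (Ψ f) = f` on the range of `restrictReal`,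
which carries the law of `Z`. -/
theorem exists_entire_extension {μ : Measure realEntire} (hμ : IsLimitLaw μ)
    {Ω' : Type*} [MeasurableSpace Ω'] {Q : Measure Ω'}
    {Z : Ω' → C(ℝ, ℝ)} (hZ : HasLaw Z (μ.map restrictReal) Q) :
    ∃ Zc : ℂ → Ω' → ℂ, (∀ ω, Differentiable ℂ fun s => Zc s ω) ∧
      (∀ᵐ ω ∂Q, ∀ s : ℝ, Zc (s : ℂ) ω = (Z ω s : ℂ)) ∧ IsCentredGaussianC Zc covc Q := by
  obtain ⟨Ψ, hΨ, hleft⟩ := exists_measurable_leftInverse_restrictReal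
  have hρ := continuous_restrictReal.measurable
  have hlaw : HasLaw (fun ω => Ψ (Z ω)) μ Q := by
    refine ⟨hΨ.comp_aemeasurable hZ.aemeasurable, ?_⟩
    have := AEMeasurable.map_map_of_aemeasurable
      (hΨ.aemeasurable (μ := Q.map Z)) hZ.aemeasurable
    rw [hZ.map_eq, Measure.map_map hΨ hρ] at this
    have hid : Ψ ∘ restrictReal = id := funext hleft
    rw [hid, Measure.map_id] at this
    exact this.symm
  refine ⟨fun s ω => (Ψ (Z ω)).1 s, fun ω => (Ψ (Z ω)).2.1, ?_, hμ.isCentredGaussianC.comp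
    (fun t => ((continuous_eval_const t).comp continuous_subtype_val).measurable) hlaw⟩
  have hae : ∀ᵐ f ∂(Q.map Z), restrictReal (Ψ f) = f := by
    rw [hZ.map_eq]
    refine (ae_map_iff hρ.aemeasurable (measurableSet_eq_fun (hρ.comp hΨ) measurable_id)).2
      (ae_of_all _ fun f => ?_)
    simp only [Function.comp_apply, id, hleft]
  filter_upwards [ae_of_ae_map hZ.aemeasurable hae] with ω hω s
  rw [← ofReal_restrictReal, hω]

end Main

end UniformLaplace

end

theorem mainTheorem7 {Ω : Type*} [MeasurableSpace Ω] (P : Measure Ω) [IsProbabilityMeasure P]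
    (U : ℕ → Ω → ℝ) (hind : iIndepFun U P)
    (hunif : ∀ k, pdf.IsUniform (U k) (Set.Icc (0 : ℝ) 1) P volume) :
    -- the centring is the expectation
    (∀ (n : ℕ) (s : ℝ), ∫ ω, UniformLaplace.Zn U n s ω ∂P = n * UniformLaplace.M s) ∧
    -- the covariance kernel is entire in each variable
    (∀ s : ℂ, Differentiable ℂ (fun w => UniformLaplace.covc s w)) ∧
    (∀ w : ℂ, Differentiable ℂ (fun s => UniformLaplace.covc s w)) ∧
    -- the limiting process exists as a random element of `C(ℝ, ℝ)`
    (∃ (Ω' : Type) (_ : MeasurableSpace Ω') (Q : Measure Ω') (_ : IsProbabilityMeasure Q)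
      (Z : Ω' → C(ℝ, ℝ)), AEMeasurable Z Q ∧
        UniformLaplace.IsCentredGaussian (fun s ω => Z ω s) UniformLaplace.cov Q) ∧
    -- every realisation `Z` of it is the limit in law and extends to a holomorphic process on `ℂ`
    (∀ (Ω' : Type*) [MeasurableSpace Ω'] (Q : Measure Ω') [IsProbabilityMeasure Q]
      (Z : Ω' → C(ℝ, ℝ)), AEMeasurable Z Q →
        UniformLaplace.IsCentredGaussian (fun s ω => Z ω s) UniformLaplace.cov Q →
        TendstoInDistribution (UniformLaplace.scaledZn U) atTop Z (fun _ => P) Q ∧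
        ∃ Zc : ℂ → Ω' → ℂ,
          (∀ ω, Differentiable ℂ (fun s => Zc s ω)) ∧
          (∀ᵐ ω ∂Q, ∀ s : ℝ, Zc (s : ℂ) ω = (Z ω s : ℂ)) ∧
          UniformLaplace.IsCentredGaussianC Zc UniformLaplace.covc Q) := by
  have hU k := UniformLaplace.hasLaw_unif_of_isUniform (hunif k)
  obtain ⟨F, μ, hF, hμF⟩ := UniformLaplace.exists_ultrafilter_tendsto_pathLaw hind hU
  have hμ := UniformLaplace.isLimitLaw_of_tendsto hind hU hF hμF
  have hMc := UniformLaplace.differentiable_Mc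
  have hρ := UniformLaplace.continuous_restrictReal
  refine ⟨UniformLaplace.integral_Zn hU, fun s => ?_, fun w => ?_,
    ⟨UniformLaplace.realEntire, inferInstance, μ, inferInstance, UniformLaplace.restrictReal,
      hρ.aemeasurable, hμ.isCentredGaussian⟩, fun Ω' _ Q _ Z hZm hZ => ?_⟩
  · simp only [UniformLaplace.covc]
    fun_prop
  · simp only [UniformLaplace.covc]
    fun_prop
  · refine ⟨UniformLaplace.tendstoInDistribution_scaledZn hind hU hμ hZm hZ,
      UniformLaplace.exists_entire_extension hμ ⟨hZm, ?_⟩⟩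
    -- `Z` and the restriction of `μ` are limits in law of the same sequence, hence have equal laws.
    have h1 := UniformLaplace.tendstoInDistribution_scaledZn hind hU hμ hZm hZ
    have h2 := UniformLaplace.tendstoInDistribution_scaledZn hind hU hμ hρ.aemeasurable
      hμ.isCentredGaussian
    exact tendstoInDistribution_unique _ h1 h2
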